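/- Let $\Lambda$ be the von Mangoldt function, $\psi(x)=\sum_{n<x}\Lambda(n)$ and $\Delta(x)=\psi(x)-x$. For real $X>1$ and $t\ge 0$ put $$f_X(t)=-\sum_{n<X}\frac{\Lambda(n)\sin(t\log n)}{\sqrt n\,\log n}+\frac{\Delta(X)\sin(t\log X)}{\sqrt X\,\log X}+\int_1^X\frac{\sin(t\log y)}{\sqrt y\,\log y}\,dy .$$ Let $E\subset[0,\infty)$ be a discrete set and let $f$ be a real function that is continuous on $[0,\infty)\setminus E$, such that $f(t)=\lim_{X\to\infty}f_X(t)$ for every $t\in[0,\infty)\setminus E$. Suppose that $f_X(t)=O(\log t)$ on $[0,\infty)\setminus E$, uniformly in $X$, in the sense that there are constants $C$ and $X_0$ with $|f_X(t)|\le C\log(t+2)$ for all $X\ge X_0$ and all $t\in[0,\infty)\setminus E$. Then the Riemann hypothesis holds: every non-trivial zero of $\zeta$ has real part $\tfrac12$. -/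

import Mathlib

open Set Filter Topology ArithmeticFunction

/-- The Chebyshev function `ψ(x) = ∑_{n < x} Λ(n)`, with the strict inequality `n < x`
(a natural number `n` satisfies `n < ⌈x⌉₊` iff `n < x`). -/
noncomputable def chebyshevPsi (x : ℝ) : ℝ :=
  ∑ n ∈ Finset.range ⌈x⌉₊, vonMangoldt n

/-- The remainder `Δ(x) = ψ(x) - x`. -/
noncomputable def chebyshevDelta (x : ℝ) : ℝ :=
  chebyshevPsi x - x

/-- The truncated Guinand expression
`f_X(t) = -∑_{n<X} Λ(n) sin(t log n) / (√n log n) + Δ(X) sin(t log X) / (√X log X)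
  + ∫_1^X sin(t log y) / (√y log y) dy`, for `X > 1`.
The terms `n = 0, 1` of the sum vanish, as `Λ(0) = Λ(1) = 0`. -/
noncomputable def guinandTrunc (X t : ℝ) : ℝ :=
  -(∑ n ∈ Finset.range ⌈X⌉₊,
      vonMangoldt n * Real.sin (t * Real.log n) / (Real.sqrt n * Real.log n))
    + chebyshevDelta X * Real.sin (t * Real.log X) / (Real.sqrt X * Real.log X)
    + ∫ y in (1 : ℝ)..X, Real.sin (t * Real.log y) / (Real.sqrt y * Real.log y)

/-! The kernel t/(a²+t²)² has sine transform π/(4a)·u·exp(-au). At u = log y the factor u cancels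
the log y in the denominators of f_X, so integrating f_X against the kernel gives π/(4a) times
-∑Λ(n)n^(-s) + Δ(X)X^(-s) + ∫₁^X y^(-s) dy, with s = 1/2 + a (`integral_guinandTrunc_mul`). For real
s > 2 this tends to π/(4a)·(ζ'/ζ(s) + 1/(s-1)).

The growth bound allows dominated convergence, so the limit is also F(a) = ∫ f(t) t/(a²+t²)² dt.
This F is holomorphic for Re a > 0 (`differentiableAt_integral_mul_div_sq_add_sq_sq`), so ζ'/ζ(s) +
1/(s-1) continues holomorphically to Re s > 1/2. That leaves no room for zeros of ζ there
(`riemannHypothesis_of_logDeriv_add_eq`), and the functional equation handles Re s < 1/2. Linear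
growth, almost everywhere and along integers X, is enough. -/

/-! ### The sine transform of the kernel. -/

open MeasureTheory Complex in
theorem integral_eq_integral_Ioi_add_comp_neg {h : ℝ → ℂ} (hh : Integrable h) :
    ∫ x, h x = ∫ x in Ioi (0 : ℝ), (h x + h (-x)) := by
  rw [integral_add hh.integrableOn hh.comp_neg.integrableOn, integral_comp_neg_Ioi, neg_zero,
    add_comm, intervalIntegral.integral_Iic_add_Ioi hh.integrableOn hh.integrableOn]

open MeasureTheory in
theorem integrableOn_Ioi_id_mul_exp_neg {a : ℝ} (ha : 0 < a) :
    IntegrableOn (fun u : ℝ => u * Real.exp (-a * u)) (Ioi 0) := by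
  simpa using integrableOn_rpow_mul_exp_neg_mul_rpow (p := 1) (s := 1) (b := a)
    (by norm_num) (by norm_num) ha

open MeasureTheory in
theorem integrableOn_Ioi_id_mul_cexp_neg {z : ℂ} (hz : 0 < z.re) :
    IntegrableOn (fun u : ℝ => (u : ℂ) * Complex.exp (-z * u)) (Ioi 0) := by
  refine (integrableOn_Ioi_id_mul_exp_neg hz).mono' (by fun_prop) ?_
  filter_upwards [ae_restrict_mem measurableSet_Ioi] with u hu
  simp [Complex.norm_exp, abs_of_pos (mem_Ioi.1 hu)]

open MeasureTheory in
theorem integral_Ioi_id_mul_cexp_neg {z : ℂ} (hz : 0 < z.re) :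
    ∫ u in Ioi (0 : ℝ), (u : ℂ) * Complex.exp (-z * u) = 1 / z ^ 2 := by
  have hz0 : z ≠ 0 := by rintro rfl; simp at hz
  have hd (x : ℝ) : HasDerivAt (fun u : ℝ => -((u : ℂ) / z + 1 / z ^ 2) * Complex.exp (-z * u))
      ((x : ℂ) * Complex.exp (-z * x)) x := by
    have h1 : HasDerivAt (fun u : ℂ => -(u / z + 1 / z ^ 2) * Complex.exp (-z * u))
      ((x : ℂ) * Complex.exp (-z * x)) x := by
      have h2 := (((hasDerivAt_id (x : ℂ)).div_const z).add_const (1 / z ^ 2)).neg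
      have h3 := ((hasDerivAt_id (x : ℂ)).const_mul (-z)).cexp
      refine (h2.mul h3).congr_deriv ?_
      simp only [id, Pi.neg_apply]
      field_simp
      ring
    exact h1.comp_ofReal
  have ht : Tendsto (fun u : ℝ => -((u : ℂ) / z + 1 / z ^ 2) * Complex.exp (-z * u)) atTop
      (𝓝 0) := by
    have e1 : Tendsto (fun u : ℝ => (u : ℂ) * Complex.exp (-z * u)) atTop (𝓝 0) := by
      rw [tendsto_zero_iff_norm_tendsto_zero]
      have := tendsto_rpow_mul_exp_neg_mul_atTop_nhds_zero 1 z.re hz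
      refine this.congr' ?_
      filter_upwards [eventually_gt_atTop 0] with u hu
      simp [Complex.norm_exp, abs_of_pos hu]
    have e2 : Tendsto (fun u : ℝ => Complex.exp (-z * u)) atTop (𝓝 0) := by
      rw [tendsto_zero_iff_norm_tendsto_zero]
      have := tendsto_rpow_mul_exp_neg_mul_atTop_nhds_zero 0 z.re hz
      refine this.congr' ?_
      filter_upwards [eventually_gt_atTop 0] with u hu
      simp [Complex.norm_exp]
    have := ((e1.const_mul (1 / z)).add (e2.const_mul (1 / z ^ 2))).neg
    simp only [mul_zero, add_zero, neg_zero] at this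
    refine this.congr fun u => ?_
    ring
  rw [integral_Ioi_of_hasDerivAt_of_tendsto' (fun x _ => hd x)
    (integrableOn_Ioi_id_mul_cexp_neg hz) ht]
  simp

open MeasureTheory in
theorem integrable_id_mul_exp_neg_abs {a : ℝ} (ha : 0 < a) :
    Integrable (fun u : ℝ => ((u * Real.exp (-a * |u|) : ℝ) : ℂ)) := by
  apply Integrable.ofReal
  rw [← integrableOn_univ, ← Iic_union_Ioi (a := (0 : ℝ)), integrableOn_union]
  have h1 : IntegrableOn (fun u : ℝ => u * Real.exp (-a * |u|)) (Ioi 0) := by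
    refine (integrableOn_Ioi_id_mul_exp_neg ha).congr_fun (fun u hu => ?_) measurableSet_Ioi
    simp [abs_of_pos (mem_Ioi.1 hu)]
  refine ⟨?_, h1⟩
  have h2 : IntegrableOn (fun u : ℝ => u * Real.exp (-a * |u|)) (Ici (-0)) := by
    rw [neg_zero]
    exact (integrableOn_Ici_iff_integrableOn_Ioi).mpr h1
  refine h2.comp_neg_Iic.neg.congr_fun (fun u _ => ?_) measurableSet_Iic
  change -(-u * Real.exp (-a * |(-u)|)) = u * Real.exp (-a * |u|)
  rw [abs_neg]
  ring

-- The function is odd, so its two halves contribute 1/(a+iτ)² - 1/(a-iτ)² with τ = 2πw.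
open MeasureTheory Real in
theorem fourier_id_mul_exp_neg_abs {a : ℝ} (ha : 0 < a) (w : ℝ) :
    FourierTransform.fourier (fun u : ℝ => ((u * Real.exp (-a * |u|) : ℝ) : ℂ)) w =
      -4 * a * Complex.I * ((2 * π * w : ℝ) / ((a ^ 2 + (2 * π * w) ^ 2 : ℝ) : ℂ) ^ 2) := by
  rw [fourier_real_eq_integral_exp_smul, integral_eq_integral_Ioi_add_comp_neg]
  · set τ : ℝ := 2 * π * w with hτ
    have hp : 0 < ((a : ℂ) + τ * Complex.I).re := by simpa using ha
    have hm : 0 < ((a : ℂ) - τ * Complex.I).re := by simpa using ha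
    have : ∀ x ∈ Ioi (0 : ℝ),
        (Complex.exp (↑(-2 * π * x * w) * Complex.I) • ((x * Real.exp (-a * |x|) : ℝ) : ℂ) +
          Complex.exp (↑(-2 * π * -x * w) * Complex.I) • ((-x * Real.exp (-a * |(-x)|) : ℝ) : ℂ))
        = (x : ℂ) * Complex.exp (-((a : ℂ) + τ * Complex.I) * x)
          - (x : ℂ) * Complex.exp (-((a : ℂ) - τ * Complex.I) * x) := by
      intro x hx
      have e1 : -((a : ℂ) + τ * Complex.I) * x =
        ↑(-2 * π * x * w) * Complex.I + ((-a * x : ℝ) : ℂ) := by push_cast [hτ]; ring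
      have e2 : -((a : ℂ) - τ * Complex.I) * x =
        ↑(-2 * π * -x * w) * Complex.I + ((-a * x : ℝ) : ℂ) := by push_cast [hτ]; ring
      rw [e1, e2, Complex.exp_add, Complex.exp_add, abs_neg, abs_of_pos (mem_Ioi.1 hx)]
      simp only [smul_eq_mul, Complex.ofReal_mul, Complex.ofReal_exp, Complex.ofReal_neg]
      ring
    rw [setIntegral_congr_fun measurableSet_Ioi this,
      integral_sub (integrableOn_Ioi_id_mul_cexp_neg hp) (integrableOn_Ioi_id_mul_cexp_neg hm),
      integral_Ioi_id_mul_cexp_neg hp, integral_Ioi_id_mul_cexp_neg hm]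
    have hp0 : (a : ℂ) + τ * Complex.I ≠ 0 := by intro h; rw [h] at hp; simp at hp
    have hm0 : (a : ℂ) - τ * Complex.I ≠ 0 := by intro h; rw [h] at hm; simp at hm
    have e : ((a ^ 2 + τ ^ 2 : ℝ) : ℂ) = (a + τ * Complex.I) * (a - τ * Complex.I) := by
      push_cast; ring_nf; simp
    rw [e]
    field_simp
    ring
  · refine (integrable_id_mul_exp_neg_abs ha).norm.mono' (by fun_prop) (ae_of_all _ fun x => ?_)
    rw [norm_smul, Complex.norm_exp_ofReal_mul_I, one_mul]

open MeasureTheory Real in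
theorem one_add_sq_le_mul_add_sq {a : ℝ} (ha : 0 < a) (t : ℝ) :
    1 + t ^ 2 ≤ (1 + 1 / a ^ 2) * (a ^ 2 + t ^ 2) := by
  have : (1 + 1 / a ^ 2) * (a ^ 2 + t ^ 2) = 1 + t ^ 2 + a ^ 2 + t ^ 2 / a ^ 2 := by
    field_simp; ring
  rw [this]; linarith [sq_nonneg a, show 0 ≤ t ^ 2 / a ^ 2 by positivity]

open MeasureTheory Real in
theorem integrable_div_add_sq_sq {a : ℝ} (ha : 0 < a) :
    Integrable (fun t : ℝ => t / (a ^ 2 + t ^ 2) ^ 2) := by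
  have hpos (t : ℝ) : 0 < a ^ 2 + t ^ 2 := by positivity
  refine (integrable_inv_one_add_sq.const_mul ((1 + 1 / a ^ 2) ^ 2)).mono'
    (Continuous.aestronglyMeasurable (by
      refine continuous_id.div (by fun_prop) fun t => (pow_pos (hpos t) 2).ne')) ?_
  refine ae_of_all _ fun t => ?_
  have h := one_add_sq_le_mul_add_sq ha t
  have h1 : |t| ≤ 1 + t ^ 2 := by nlinarith [sq_abs t, sq_nonneg (|t| - 1)]
  rw [Real.norm_eq_abs, abs_div, abs_of_pos (pow_pos (hpos t) 2), ← div_eq_mul_inv,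
    div_le_div_iff₀ (pow_pos (hpos t) 2) (by positivity)]
  calc |t| * (1 + t ^ 2) ≤ (1 + t ^ 2) * (1 + t ^ 2) := by gcongr
    _ ≤ ((1 + 1 / a ^ 2) * (a ^ 2 + t ^ 2)) * ((1 + 1 / a ^ 2) * (a ^ 2 + t ^ 2)) := by gcongr
    _ = _ := by ring

open MeasureTheory Real in
/-- The sine transform of `t / (a² + t²)²`. -/
theorem integral_Ioi_sin_mul_div_add_sq_sq {a : ℝ} (ha : 0 < a) {u : ℝ} (hu : 0 ≤ u) :
    ∫ t in Ioi (0 : ℝ), Real.sin (t * u) * (t / (a ^ 2 + t ^ 2) ^ 2) =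
      π / (4 * a) * (u * Real.exp (-a * u)) := by
  set g : ℝ → ℂ := fun u : ℝ => ((u * Real.exp (-a * |u|) : ℝ) : ℂ) with hg
  have hF : FourierTransform.fourier g = fun w : ℝ =>
      -4 * a * Complex.I * (((2 * π * w) / (a ^ 2 + (2 * π * w) ^ 2) ^ 2 : ℝ) : ℂ) := by
    ext w
    rw [fourier_id_mul_exp_neg_abs ha]
    push_cast
    rfl
  have hFint : Integrable (FourierTransform.fourier g) := by
    rw [hF]
    exact (((integrable_div_add_sq_sq ha).comp_mul_left' (by positivity)).ofReal).const_mul _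
  -- Fourier inversion recovers g from its odd transform; pairing w with -w leaves only the sine,
  -- and t = 2πw rescales.
  have hinv := congrFun (Continuous.fourierInv_fourier_eq (f := g) (by fun_prop)
    (integrable_id_mul_exp_neg_abs ha) hFint) u
  rw [fourierInv_eq', integral_eq_integral_Ioi_add_comp_neg] at hinv
  · have : ∀ w ∈ Ioi (0 : ℝ),
        (Complex.exp (↑(2 * π * inner ℝ w u) * Complex.I) • FourierTransform.fourier g w +
         Complex.exp (↑(2 * π * inner ℝ (-w) u) * Complex.I) • FourierTransform.fourier g (-w))
        = ((8 * a * (Real.sin ((2 * π * w) * u) *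
            ((2 * π * w) / (a ^ 2 + (2 * π * w) ^ 2) ^ 2)) : ℝ) : ℂ) := by
      intro w _
      simp only [hF, smul_eq_mul]
      have e1 : (2 * π * inner ℝ w u) = 2 * π * w * u := by simp; ring
      have e2 : (2 * π * inner ℝ (-w) u) = -(2 * π * w * u) := by simp; ring
      rw [e1, e2]
      generalize 2 * π * w * u = x
      rw [show 2 * π * -w = -(2 * π * w) by ring]
      generalize 2 * π * w = y
      rw [Complex.ofReal_neg, neg_mul, neg_sq, neg_div, Complex.ofReal_neg]
      push_cast
      rw [Complex.sin]
      ring_nf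
    rw [setIntegral_congr_fun measurableSet_Ioi this, integral_complex_ofReal, hg] at hinv
    replace hinv := Complex.ofReal_injective hinv
    rw [integral_const_mul, integral_comp_mul_left_Ioi
      (fun t => Real.sin (t * u) * (t / (a ^ 2 + t ^ 2) ^ 2)) 0 (by positivity : 0 < 2 * π),
      mul_zero, abs_of_nonneg hu, smul_eq_mul] at hinv
    rw [← hinv]
    generalize ∫ t in Ioi (0 : ℝ), Real.sin (t * u) * (t / (a ^ 2 + t ^ 2) ^ 2) = J
    field_simp
    ring
  · refine hFint.norm.mono' ?_ (ae_of_all _ fun x => ?_)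
    · exact (by fun_prop : Continuous fun x : ℝ =>
        Complex.exp (↑(2 * π * inner ℝ x u) * Complex.I)).aestronglyMeasurable.smul hFint.aestronglyMeasurable
    · rw [norm_smul, Complex.norm_exp_ofReal_mul_I, one_mul]

/-! ### Integrating the truncated expression against the kernel. -/

-- The extra factor t pays for the bound in `abs_sin_mul_log_div_le` and for linear growth of f.
open MeasureTheory Real in
theorem integrable_mul_div_add_sq_sq {a : ℝ} (ha : 0 < a) :
    Integrable (fun t : ℝ => t * (t / (a ^ 2 + t ^ 2) ^ 2)) := by
  have hpos (t : ℝ) : 0 < a ^ 2 + t ^ 2 := by positivity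
  refine (integrable_inv_one_add_sq.const_mul ((1 + 1 / a ^ 2) ^ 2)).mono'
    (Continuous.aestronglyMeasurable (by
      refine continuous_id.mul (continuous_id.div (by fun_prop)
        fun t => (pow_pos (hpos t) 2).ne'))) ?_
  refine ae_of_all _ fun t => ?_
  have h := one_add_sq_le_mul_add_sq ha t
  rw [Real.norm_eq_abs, abs_of_nonneg (by rw [← mul_div_assoc]; positivity [mul_self_nonneg t]),
    ← mul_div_assoc, ← div_eq_mul_inv,
    div_le_div_iff₀ (pow_pos (hpos t) 2) (by positivity)]
  calc t * t * (1 + t ^ 2) ≤ (1 + t ^ 2) * (1 + t ^ 2) := by gcongr; nlinarith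
    _ ≤ ((1 + 1 / a ^ 2) * (a ^ 2 + t ^ 2)) * ((1 + 1 / a ^ 2) * (a ^ 2 + t ^ 2)) := by gcongr
    _ = _ := by ring

open MeasureTheory Real in
theorem integrableOn_sin_mul_div_add_sq_sq {a : ℝ} (ha : 0 < a) (u : ℝ) :
    IntegrableOn (fun t : ℝ => Real.sin (t * u) * (t / (a ^ 2 + t ^ 2) ^ 2)) (Ioi 0) := by
  refine Integrable.integrableOn ?_
  refine (integrable_div_add_sq_sq ha).bdd_mul (c := 1)
    (by fun_prop : Continuous fun t : ℝ => Real.sin (t * u)).aestronglyMeasurable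
    (ae_of_all _ fun t => ?_)
  exact Real.abs_sin_le_one _

theorem log_mul_exp_div_sqrt_mul_log {a y : ℝ} (hy : 1 < y) :
    Real.log y * Real.exp (-a * Real.log y) / (Real.sqrt y * Real.log y) =
      y ^ (-(1 / 2 + a)) := by
  have hy0 : 0 < y := by linarith
  have hl := Real.log_pos hy
  rw [show -(1 / 2 + a) = -a - 1 / 2 by ring, Real.rpow_sub hy0, ← Real.sqrt_eq_rpow,
    Real.rpow_def_of_pos hy0, mul_comm (Real.log y) (-a)]
  field_simp

open MeasureTheory Real in
theorem integral_sin_log_mul_div_add_sq_sq {a y : ℝ} (ha : 0 < a) (hy : 1 < y) :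
    ∫ t in Ioi (0 : ℝ), Real.sin (t * Real.log y) / (Real.sqrt y * Real.log y) *
      (t / (a ^ 2 + t ^ 2) ^ 2) = π / (4 * a) * y ^ (-(1 / 2 + a)) := by
  rw [← log_mul_exp_div_sqrt_mul_log (a := a) hy, mul_div_assoc',
    ← integral_Ioi_sin_mul_div_add_sq_sq ha (Real.log_pos hy).le, ← integral_div]
  congr 1 with t
  ring

/-- From |sin x| ≤ |x|. The bound is uniform as y → 1, where 1/log y blows up, and so justifies
Fubini on (0,∞) × (1,X]. -/
theorem abs_sin_mul_log_div_le {t y : ℝ} (ht : 0 ≤ t) (hy : 1 < y) :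
    |Real.sin (t * Real.log y) / (Real.sqrt y * Real.log y)| ≤ t := by
  have hl := Real.log_pos hy
  have hs : 1 ≤ Real.sqrt y := Real.one_le_sqrt.2 hy.le
  rw [abs_div, abs_of_pos (by positivity : 0 < Real.sqrt y * Real.log y),
    div_le_iff₀ (by positivity)]
  calc |Real.sin (t * Real.log y)| ≤ |t * Real.log y| := Real.abs_sin_le_abs
    _ = t * (1 * Real.log y) := by rw [abs_of_nonneg (by positivity), one_mul]
    _ ≤ _ := by gcongr

open MeasureTheory Real in
theorem integrable_prod_sin_log_mul {a : ℝ} (ha : 0 < a) (X : ℝ) :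
    Integrable (Function.uncurry fun t y : ℝ =>
      Real.sin (t * Real.log y) / (Real.sqrt y * Real.log y) * (t / (a ^ 2 + t ^ 2) ^ 2))
      ((volume.restrict (Ioi 0)).prod (volume.restrict (Ioc 1 X))) := by
  have hb : Integrable (fun p : ℝ × ℝ => (p.1 * (p.1 / (a ^ 2 + p.1 ^ 2) ^ 2)) * (1 : ℝ))
      ((volume.restrict (Ioi 0)).prod (volume.restrict (Ioc 1 X))) :=
    Integrable.mul_prod (f := fun t : ℝ => t * (t / (a ^ 2 + t ^ 2) ^ 2)) (g := fun _ => (1 : ℝ))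
      (integrable_mul_div_add_sq_sq ha).integrableOn (integrable_const _)
  refine hb.mono' (Measurable.aestronglyMeasurable (by unfold Function.uncurry; fun_prop)) ?_
  rw [Measure.prod_restrict]
  filter_upwards [ae_restrict_mem (measurableSet_Ioi.prod measurableSet_Ioc)] with p hp
  have ht : 0 < p.1 := hp.1
  rw [Function.uncurry, norm_mul, mul_one, Real.norm_eq_abs, Real.norm_eq_abs,
    abs_of_nonneg (by positivity : 0 ≤ p.1 / (a ^ 2 + p.1 ^ 2) ^ 2)]
  gcongr
  exact abs_sin_mul_log_div_le ht.le hp.2.1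

open MeasureTheory Real in
theorem integral_intervalIntegral_sin_log_mul {a X : ℝ} (ha : 0 < a) (hX : 1 < X) :
    ∫ t in Ioi (0 : ℝ), (∫ y in (1 : ℝ)..X,
      Real.sin (t * Real.log y) / (Real.sqrt y * Real.log y)) * (t / (a ^ 2 + t ^ 2) ^ 2) =
      π / (4 * a) * ∫ y in (1 : ℝ)..X, y ^ (-(1 / 2 + a)) := by
  simp_rw [← intervalIntegral.integral_mul_const, ← intervalIntegral.integral_const_mul,
    intervalIntegral.integral_of_le hX.le]
  rw [integral_integral_swap (integrable_prod_sin_log_mul ha X)]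
  exact setIntegral_congr_fun measurableSet_Ioc fun y hy =>
    integral_sin_log_mul_div_add_sq_sq ha hy.1

open MeasureTheory Real in
theorem integrableOn_intervalIntegral_sin_log_mul {a X : ℝ} (ha : 0 < a) (hX : 1 < X) :
    IntegrableOn (fun t : ℝ => (∫ y in (1 : ℝ)..X,
      Real.sin (t * Real.log y) / (Real.sqrt y * Real.log y)) * (t / (a ^ 2 + t ^ 2) ^ 2))
      (Ioi 0) := by
  simp_rw [← intervalIntegral.integral_mul_const, intervalIntegral.integral_of_le hX.le]
  exact (integrable_prod_sin_log_mul ha X).integral_prod_left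

open MeasureTheory Real in
theorem guinandTrunc_mul_eq (X t k : ℝ) :
    guinandTrunc X t * k =
      -(∑ n ∈ Finset.range ⌈X⌉₊, vonMangoldt n *
        (Real.sin (t * Real.log n) / (Real.sqrt n * Real.log n) * k))
      + chebyshevDelta X * (Real.sin (t * Real.log X) / (Real.sqrt X * Real.log X) * k)
      + (∫ y in (1 : ℝ)..X, Real.sin (t * Real.log y) / (Real.sqrt y * Real.log y)) * k := by
  rw [guinandTrunc, add_mul, add_mul, neg_mul, Finset.sum_mul]
  congr 1
  congr 1
  · congr 1
    exact Finset.sum_congr rfl fun n _ => by ring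
  · ring

open MeasureTheory Real in
theorem integrableOn_sin_log_div_mul {a : ℝ} (ha : 0 < a) (u v : ℝ) :
    IntegrableOn (fun t : ℝ => Real.sin (t * u) / v * (t / (a ^ 2 + t ^ 2) ^ 2)) (Ioi 0) :=
  ((integrableOn_sin_mul_div_add_sq_sq ha u).div_const v).congr (ae_of_all _ fun t => by ring)

open MeasureTheory Real in
theorem integrableOn_guinandTrunc_mul {a X : ℝ} (ha : 0 < a) (hX : 1 < X) :
    IntegrableOn (fun t => guinandTrunc X t * (t / (a ^ 2 + t ^ 2) ^ 2)) (Ioi 0) := by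
  simp_rw [guinandTrunc_mul_eq]
  exact ((integrable_finsetSum _ fun n _ =>
    (integrableOn_sin_log_div_mul ha _ _).const_mul _).neg.add
    ((integrableOn_sin_log_div_mul ha _ _).const_mul _)).add
    (integrableOn_intervalIntegral_sin_log_mul ha hX)

open MeasureTheory Real in
theorem integral_guinandTrunc_mul {a X : ℝ} (ha : 0 < a) (hX : 1 < X) :
    ∫ t in Ioi (0 : ℝ), guinandTrunc X t * (t / (a ^ 2 + t ^ 2) ^ 2) =
      π / (4 * a) * (-(∑ n ∈ Finset.range ⌈X⌉₊, vonMangoldt n * (n : ℝ) ^ (-(1 / 2 + a)))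
        + chebyshevDelta X * X ^ (-(1 / 2 + a)) + ∫ y in (1 : ℝ)..X, y ^ (-(1 / 2 + a))) := by
  simp_rw [guinandTrunc_mul_eq]
  have i1 : ∀ n ∈ Finset.range ⌈X⌉₊, Integrable (fun t : ℝ => vonMangoldt n *
        (Real.sin (t * Real.log n) / (Real.sqrt n * Real.log n) * (t / (a ^ 2 + t ^ 2) ^ 2)))
      (volume.restrict (Ioi 0)) := fun n _ => (integrableOn_sin_log_div_mul ha _ _).const_mul _
  have i2 := (integrableOn_sin_log_div_mul ha (Real.log X) (Real.sqrt X * Real.log X)).const_mul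
    (chebyshevDelta X)
  have i3 := integrableOn_intervalIntegral_sin_log_mul ha hX
  have i4 : Integrable (fun t : ℝ => -∑ n ∈ Finset.range ⌈X⌉₊, vonMangoldt n *
        (Real.sin (t * Real.log n) / (Real.sqrt n * Real.log n) * (t / (a ^ 2 + t ^ 2) ^ 2)))
      (volume.restrict (Ioi 0)) := (integrable_finsetSum _ i1).neg
  have i5 : Integrable (fun t : ℝ => -∑ n ∈ Finset.range ⌈X⌉₊, vonMangoldt n *
        (Real.sin (t * Real.log n) / (Real.sqrt n * Real.log n) * (t / (a ^ 2 + t ^ 2) ^ 2)) +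
      chebyshevDelta X *
        (Real.sin (t * Real.log X) / (Real.sqrt X * Real.log X) * (t / (a ^ 2 + t ^ 2) ^ 2)))
      (volume.restrict (Ioi 0)) := i4.add i2
  rw [integral_add i5 i3, integral_add i4 i2, integral_neg, integral_finsetSum _ i1,
    integral_intervalIntegral_sin_log_mul ha hX, integral_const_mul,
    integral_sin_log_mul_div_add_sq_sq ha hX, mul_add, mul_add, mul_neg, Finset.mul_sum]
  congr 1
  congr 1
  · congr 1
    refine Finset.sum_congr rfl fun n _ => ?_
    rw [integral_const_mul]
    -- The transform formula needs log n > 0; for n ≤ 1 the coefficient Λ(n) vanishes.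
    by_cases hn : 1 < n
    · rw [integral_sin_log_mul_div_add_sq_sq ha (by exact_mod_cast hn)]
      ring
    · have : vonMangoldt n = 0 := by
        interval_cases n <;> simp
      simp [this]
  · ring

/-! ### Holomorphy of the transform in the parameter. -/

/-- Factor a² + t² = (a+it)(a-it); the factors have squared moduli (Re a)² + (Im a ± t)². The
constant satisfies K ≥ 2 and Kδ² ≥ 2M² + 1, so each is at least (1+t²)/K. -/
theorem one_add_sq_le_mul_norm_sq_add_sq {δ M : ℝ} (hδ : 0 < δ) {a : ℂ} (ha : δ ≤ a.re)
    (haM : |a.im| ≤ M) (t : ℝ) :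
    1 + t ^ 2 ≤ (2 + (2 * M ^ 2 + 1) / δ ^ 2) * ‖a ^ 2 + (t : ℂ) ^ 2‖ := by
  set K := 2 + (2 * M ^ 2 + 1) / δ ^ 2 with hK
  have hK0 : 0 < K := by positivity
  have hM : a.im ^ 2 ≤ M ^ 2 := sq_le_sq' (abs_le.1 haM).1 (abs_le.1 haM).2
  have hre : δ ^ 2 ≤ a.re ^ 2 := by gcongr
  have key (s : ℝ) : 1 + s ^ 2 ≤ K * (a.re ^ 2 + (a.im + s) ^ 2) := by
    have h1 : (2 * M ^ 2 + 1) / δ ^ 2 * δ ^ 2 = 2 * M ^ 2 + 1 := by field_simp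
    calc 1 + s ^ 2 ≤ 2 * (a.im + s) ^ 2 + (2 * M ^ 2 + 1) := by nlinarith [sq_nonneg (2 * a.im + s)]
      _ = 2 * (a.im + s) ^ 2 + (2 * M ^ 2 + 1) / δ ^ 2 * δ ^ 2 := by rw [h1]
      _ ≤ K * (a.im + s) ^ 2 + K * a.re ^ 2 := by
        gcongr
        · rw [hK]; linarith [show 0 ≤ (2 * M ^ 2 + 1) / δ ^ 2 by positivity]
        · rw [hK]; linarith
      _ = _ := by ring
  have e : ‖a ^ 2 + (t : ℂ) ^ 2‖ ^ 2 =
      (a.re ^ 2 + (a.im + t) ^ 2) * (a.re ^ 2 + (a.im + -t) ^ 2) := by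
    rw [← Complex.normSq_eq_norm_sq, Complex.normSq_apply]
    simp [pow_two]
    ring
  refine (sq_le_sq₀ (by positivity) (by positivity)).1 ?_
  rw [mul_pow, e]
  calc (1 + t ^ 2) ^ 2 = (1 + t ^ 2) * (1 + (-t) ^ 2) := by ring
    _ ≤ (K * (a.re ^ 2 + (a.im + t) ^ 2)) * (K * (a.re ^ 2 + (a.im + -t) ^ 2)) := by
      gcongr
      · exact key t
      · exact key (-t)
    _ = _ := by ring

open MeasureTheory in
theorem differentiableAt_integral_mul_div_sq_add_sq_sq {f : ℝ → ℝ} {C : ℝ}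
    (hfm : AEStronglyMeasurable f (volume.restrict (Ioi 0)))
    (hfb : ∀ᵐ t ∂volume.restrict (Ioi (0 : ℝ)), |f t| ≤ C * (1 + t)) {a : ℂ} (ha : 0 < a.re) :
    DifferentiableAt ℂ
      (fun a : ℂ => ∫ t in Ioi (0 : ℝ), (f t : ℂ) * (t / (a ^ 2 + (t : ℂ) ^ 2) ^ 2)) a := by
  -- Half the real part keeps the ball away from the imaginary axis, where the kernel has poles.
  set δ := a.re / 2 with hδ
  have hδ0 : 0 < δ := by positivity
  set M := |a.im| + δ with hM
  set K := 2 + (2 * M ^ 2 + 1) / δ ^ 2 with hK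
  have hK0 : 0 < K := by positivity
  have hball {b : ℂ} (hb : b ∈ Metric.ball a δ) : δ ≤ b.re ∧ |b.im| ≤ M ∧ ‖b‖ ≤ ‖a‖ + δ := by
    rw [Metric.mem_ball, dist_eq_norm] at hb
    have h1 := (Complex.abs_re_le_norm (b - a)).trans hb.le
    have h2 := (Complex.abs_im_le_norm (b - a)).trans hb.le
    rw [Complex.sub_re, abs_le] at h1
    rw [Complex.sub_im] at h2
    refine ⟨by linarith [h1.1], ?_, ?_⟩
    · have := abs_sub_abs_le_abs_sub b.im a.im
      linarith
    · have := norm_sub_norm_le b a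
      linarith
  have hlow {b : ℂ} (hb : b ∈ Metric.ball a δ) (t : ℝ) :
      1 + t ^ 2 ≤ K * ‖b ^ 2 + (t : ℂ) ^ 2‖ :=
    one_add_sq_le_mul_norm_sq_add_sq hδ0 (hball hb).1 (hball hb).2.1 t
  have hne {b : ℂ} (hb : b ∈ Metric.ball a δ) (t : ℝ) : b ^ 2 + (t : ℂ) ^ 2 ≠ 0 := by
    intro h
    have := hlow hb t
    rw [h, norm_zero, mul_zero] at this
    nlinarith [sq_nonneg t]
  have hmem : Metric.ball a δ ∈ 𝓝 a := Metric.ball_mem_nhds a hδ0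
  have haa : a ∈ Metric.ball a δ := Metric.mem_ball_self hδ0
  have hfm' : AEStronglyMeasurable (fun t => (f t : ℂ)) (volume.restrict (Ioi 0)) :=
    Complex.continuous_ofReal.comp_aestronglyMeasurable hfm
  have hkey (t : ℝ) : (1 + t) * t ≤ 2 * (1 + t ^ 2) := by nlinarith [sq_nonneg (t - 1)]
  refine (hasDerivAt_integral_of_dominated_loc_of_deriv_le (𝕜 := ℂ) (s := Metric.ball a δ)
    (F' := fun b t => (f t : ℂ) * (-4 * b * t / (b ^ 2 + (t : ℂ) ^ 2) ^ 3))
    (bound := fun t => 8 * |C| * (‖a‖ + δ) * K ^ 3 * (1 + t ^ 2)⁻¹) hmem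
    ?_ ?_ ?_ ?_ ?_ ?_).2.differentiableAt
  · exact Eventually.of_forall fun b =>
      hfm'.mul (Measurable.aestronglyMeasurable (by fun_prop))
  · refine Integrable.mono' (g := fun t => 2 * |C| * K ^ 2 * (1 + t ^ 2)⁻¹)
      (integrable_inv_one_add_sq.const_mul _).integrableOn
      (hfm'.mul (Measurable.aestronglyMeasurable (by fun_prop))) ?_
    filter_upwards [hfb, ae_restrict_mem measurableSet_Ioi] with t ht ht0
    have ht0 : 0 < t := ht0
    have hl := hlow haa t
    have hp : 0 < ‖a ^ 2 + (t : ℂ) ^ 2‖ := norm_pos_iff.2 (hne haa t)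
    rw [norm_mul, norm_div, norm_pow, Complex.norm_real, Complex.norm_real, Real.norm_eq_abs,
      Real.norm_eq_abs, abs_of_pos ht0, ← div_eq_mul_inv, ← mul_div_assoc,
      div_le_div_iff₀ (by positivity) (by positivity)]
    have hC : |f t| ≤ |C| * (1 + t) := ht.trans (by gcongr; exact le_abs_self C)
    calc |f t| * t * (1 + t ^ 2) ≤ |C| * (1 + t) * t * (1 + t ^ 2) := by gcongr
      _ = |C| * ((1 + t) * t) * (1 + t ^ 2) := by ring
      _ ≤ |C| * (2 * (1 + t ^ 2)) * (1 + t ^ 2) := by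
        gcongr |C| * ?_ * (1 + t ^ 2)
        exact hkey t
      _ = 2 * |C| * (1 + t ^ 2) ^ 2 := by ring
      _ ≤ 2 * |C| * (K * ‖a ^ 2 + (t : ℂ) ^ 2‖) ^ 2 := by gcongr
      _ = _ := by ring
  · exact hfm'.mul (Measurable.aestronglyMeasurable (by fun_prop))
  · filter_upwards [hfb, ae_restrict_mem measurableSet_Ioi] with t ht ht0 b hb
    have ht0 : 0 < t := ht0
    have hl := hlow hb t
    have hp : 0 < ‖b ^ 2 + (t : ℂ) ^ 2‖ := norm_pos_iff.2 (hne hb t)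
    have hC : |f t| ≤ |C| * (1 + t) := ht.trans (by gcongr; exact le_abs_self C)
    have hb' := (hball hb).2.2
    rw [norm_mul, norm_div, norm_pow, norm_mul, norm_mul, Complex.norm_real, Complex.norm_real,
      Real.norm_eq_abs, Real.norm_eq_abs, abs_of_pos ht0, ← div_eq_mul_inv, ← mul_div_assoc,
      div_le_div_iff₀ (by positivity) (by positivity), show ‖(-4 : ℂ)‖ = 4 by simp]
    calc |f t| * (4 * ‖b‖ * t) * (1 + t ^ 2)
        ≤ |C| * (1 + t) * (4 * (‖a‖ + δ) * t) * (1 + t ^ 2) := by gcongr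
      _ = 4 * |C| * (‖a‖ + δ) * ((1 + t) * t) * (1 + t ^ 2) * 1 := by ring
      -- The spare factor 1 is enlarged to 1 + t² to match the cubed denominator.
      _ ≤ 4 * |C| * (‖a‖ + δ) * (2 * (1 + t ^ 2)) * (1 + t ^ 2) * (1 + t ^ 2) := by
        gcongr 4 * |C| * (‖a‖ + δ) * ?_ * (1 + t ^ 2) * ?_
        · exact hkey t
        · linarith [sq_nonneg t]
      _ = 8 * |C| * (‖a‖ + δ) * (1 + t ^ 2) ^ 3 := by ring
      _ ≤ 8 * |C| * (‖a‖ + δ) * (K * ‖b ^ 2 + (t : ℂ) ^ 2‖) ^ 3 := by gcongr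
      _ = _ := by ring
  · exact (integrable_inv_one_add_sq.const_mul _).integrableOn
  · refine ae_of_all _ fun t b hb => ?_
    have h0 := hne hb t
    have h1 : HasDerivAt (fun b : ℂ => b ^ 2 + (t : ℂ) ^ 2) (2 * b) b := by
      simpa using (hasDerivAt_pow 2 b).add_const ((t : ℂ) ^ 2)
    have h2 := (((h1.pow 2).inv (pow_ne_zero 2 h0)).const_mul (t : ℂ)).const_mul (f t : ℂ)
    refine (h2.congr_deriv ?_).congr_of_eventuallyEq ?_
    · simp only [Pi.pow_apply]
      field_simp
      push_cast
      ring
    · exact Eventually.of_forall fun b => by simp [div_eq_mul_inv]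

/-! ### From the logarithmic derivative to the Riemann hypothesis. -/

/-- A solution of `Z' = Z H` with a zero on a preconnected open set vanishes there. -/
theorem eqOn_zero_of_deriv_eq_mul {U : Set ℂ} (hU : IsOpen U) (hUc : IsPreconnected U)
    {Z H : ℂ → ℂ} (hZ : DifferentiableOn ℂ Z U) (hH : DifferentiableOn ℂ H U)
    (h : ∀ s ∈ U, deriv Z s = Z s * H s) {s₀ : ℂ} (hs₀ : s₀ ∈ U) (h0 : Z s₀ = 0) :
    EqOn Z 0 U := by
  obtain ⟨r, hr, hrU⟩ := Metric.isOpen_iff.1 hU s₀ hs₀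
  -- With P a primitive of H on the ball, Z·exp(-P) is constant there, hence zero; the identity
  -- theorem spreads this to U.
  obtain ⟨P, hP⟩ := (hH.mono hrU).isExactOn_ball
  have hd : ∀ z ∈ Metric.ball s₀ r,
      HasDerivAt (fun z => Z z * Complex.exp (-P z)) 0 z := by
    intro z hz
    have h1 := ((hZ.differentiableAt (hU.mem_nhds (hrU hz))).hasDerivAt).mul (hP z hz).neg.cexp
    refine h1.congr_deriv ?_
    simp only [Pi.neg_apply]
    rw [h z (hrU hz)]
    ring
  have hconst : ∀ z ∈ Metric.ball s₀ r, Z z = 0 := by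
    intro z hz
    have := (convex_ball s₀ r).is_const_of_fderivWithin_eq_zero (𝕜 := ℂ)
      (f := fun z => Z z * Complex.exp (-P z))
      (fun w hw => (hd w hw).differentiableAt.differentiableWithinAt)
      (fun w hw => by
        rw [fderivWithin_of_isOpen Metric.isOpen_ball hw]
        ext
        simpa using (hd w hw).deriv)
      hz (Metric.mem_ball_self hr)
    simpa [h0, Complex.exp_ne_zero] using this
  exact (hZ.analyticOnNhd hU).eqOn_zero_of_preconnected_of_eventuallyEq_zero hUc hs₀
    (eventually_of_mem (Metric.ball_mem_nhds s₀ hr) hconst)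

/-- For a zero s left of the critical line, ζ(1-s) ≠ 0, so the functional equation forces its cosine
factor to vanish. Then s is an even integer, and Re s < 1/2 makes it a trivial zero. -/
theorem riemannHypothesis_of_ne_zero_of_half_lt_re
    (h : ∀ s : ℂ, 1 / 2 < s.re → s ≠ 1 → riemannZeta s ≠ 0) : RiemannHypothesis := by
  intro s hs htriv hs1
  rcases lt_trichotomy s.re (1 / 2) with hlt | heq | hgt
  · exfalso
    have hw : 1 / 2 < (1 - s).re := by rw [Complex.sub_re, Complex.one_re]; linarith
    have hw1 : 1 - s ≠ 1 := by
      intro e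
      have : s = 0 := by linear_combination -e
      rw [this, riemannZeta_zero] at hs
      norm_num at hs
    have hwn (n : ℕ) : 1 - s ≠ -n := by
      intro e
      rw [e] at hw
      simp only [Complex.neg_re, Complex.natCast_re] at hw
      linarith [show (0 : ℝ) ≤ n from n.cast_nonneg]
    have hfe := riemannZeta_one_sub hwn hw1
    rw [sub_sub_cancel, hs] at hfe
    have hΓ : Complex.Gamma (1 - s) ≠ 0 := Complex.Gamma_ne_zero_of_re_pos (by linarith)
    have hpow : (2 * (Real.pi : ℂ)) ^ (-(1 - s)) ≠ 0 := by
      rw [Complex.cpow_ne_zero_iff]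
      left
      simp [Real.pi_ne_zero]
    have hcos : Complex.cos (Real.pi * (1 - s) / 2) = 0 := by
      by_contra hc
      exact mul_ne_zero (mul_ne_zero (mul_ne_zero (mul_ne_zero two_ne_zero hpow) hΓ) hc)
        (h _ hw hw1) hfe.symm
    obtain ⟨k, hk⟩ := Complex.cos_eq_zero_iff.1 hcos
    have hk' : s = -2 * k := by
      have hpi : (Real.pi : ℂ) ≠ 0 := by exact_mod_cast Real.pi_ne_zero
      have := mul_left_cancel₀ hpi (show (Real.pi : ℂ) * (1 - s) = Real.pi * (2 * k + 1) by
        linear_combination 2 * hk)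
      linear_combination -this
    have hre : s.re = -2 * k := by rw [hk']; simp
    have hk0 : 0 < k := by
      have h0 : k ≠ 0 := by
        rintro rfl
        exact hw1 (by rw [hk']; simp)
      have : (-1 : ℝ) < k := by linarith
      have : (-1 : ℤ) < k := by exact_mod_cast this
      omega
    -- Trivial zeros are indexed as -2(n+1), hence the shift.
    refine htriv ⟨(k - 1).toNat, ?_⟩
    rw [hk']
    have : (((k - 1).toNat : ℤ) : ℂ) = ((k - 1 : ℤ) : ℂ) := by rw [Int.toNat_of_nonneg (by omega)]
    rw [Int.cast_natCast] at this
    rw [this]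
    push_cast
    ring
  · exact heq
  · exact absurd hs (h s hgt hs1)

-- The entire function Z = (s-1)ζ(s) satisfies Z' = ZH on a real ray, hence on the half-plane by the
-- identity theorem. A zero of ζ would force Z ≡ 0 there, contradicting ζ(2) ≠ 0. The product form
-- avoids dividing by possible zeros.
open DirichletCharacter in
theorem riemannHypothesis_of_logDeriv_add_eq {H : ℂ → ℂ}
    (hH : DifferentiableOn ℂ H {s | 1 / 2 < s.re}) {σ₀ : ℝ} (hσ₀ : 1 < σ₀)
    (h : ∀ σ : ℝ, σ₀ < σ →
      deriv riemannZeta σ / riemannZeta σ + 1 / ((σ : ℂ) - 1) = H σ) :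
    RiemannHypothesis := by
  have hL : LFunctionTrivChar 1 = riemannZeta := by
    rw [LFunctionTrivChar, LFunction_modOne_eq]
  set Z := LFunctionTrivChar₁ 1 with hZ
  have hZd : Differentiable ℂ Z := differentiable_LFunctionTrivChar₁ 1
  have hZeq {s : ℂ} (hs : s ≠ 1) : Z s = (s - 1) * riemannZeta s := by
    rw [hZ, LFunctionTrivChar₁, Function.update_of_ne hs, hL]
  have hU : IsOpen {s : ℂ | 1 / 2 < s.re} := isOpen_lt continuous_const Complex.continuous_re
  have hUc : IsPreconnected {s : ℂ | 1 / 2 < s.re} := (convex_halfSpace_re_gt _).isPreconnected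
  have hreal : ∀ σ : ℝ, σ₀ < σ → deriv Z σ = Z σ * H σ := by
    intro σ hσ
    have h1 : (σ : ℂ) ≠ 1 := by
      intro e
      have : σ = 1 := by exact_mod_cast e
      linarith
    have hζ : riemannZeta σ ≠ 0 := riemannZeta_ne_zero_of_one_le_re (by simp; linarith)
    have h1' : (σ : ℂ) - 1 ≠ 0 := sub_ne_zero.2 h1
    rw [← h σ hσ, hZeq h1, hZ, deriv_LFunctionTrivChar₁_apply_of_ne_one 1 h1, hL]
    field_simp
  have hode : EqOn (deriv Z) (fun s => Z s * H s) {s | 1 / 2 < s.re} := by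
    have htend : Tendsto ((↑) : ℝ → ℂ) (𝓝[≠] (σ₀ + 1)) (𝓝[≠] ((σ₀ + 1 : ℝ) : ℂ)) :=
      tendsto_nhdsWithin_iff.2 ⟨(Complex.continuous_ofReal.tendsto _).mono_left
        nhdsWithin_le_nhds, eventually_nhdsWithin_of_forall fun x hx => by
          simpa using fun e => hx (Complex.ofReal_injective e)⟩
    have hev : ∀ᶠ σ : ℝ in 𝓝[≠] (σ₀ + 1), deriv Z σ = Z σ * H σ :=
      ((lt_mem_nhds (show σ₀ < σ₀ + 1 by linarith)).mono hreal).filter_mono nhdsWithin_le_nhds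
    refine AnalyticOnNhd.eqOn_of_preconnected_of_frequently_eq
      (hZd.differentiableOn.analyticOnNhd hU).deriv
      ((hZd.differentiableOn.mul hH).analyticOnNhd hU) hUc
      (z₀ := ((σ₀ + 1 : ℝ) : ℂ)) ?_ (htend.frequently hev.frequently)
    rw [mem_ofPred_eq, Complex.ofReal_re]
    linarith
  refine riemannHypothesis_of_ne_zero_of_half_lt_re fun s hs hs1 h0 => ?_
  have hzero := eqOn_zero_of_deriv_eq_mul hU hUc hZd.differentiableOn hH hode hs
    (by rw [hZeq hs1, h0, mul_zero])
  have h2 := hzero (show (2 : ℂ) ∈ {s : ℂ | 1 / 2 < s.re} by norm_num)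
  rw [hZeq (by norm_num), Pi.zero_apply] at h2
  exact mul_ne_zero (by norm_num) (riemannZeta_ne_zero_of_one_le_re (by norm_num)) h2

/-! ### Limits of the three terms for large real s. -/

theorem chebyshevPsi_natCast (N : ℕ) :
    chebyshevPsi N = ∑ n ∈ Finset.range N, vonMangoldt n := by
  rw [chebyshevPsi, Nat.ceil_natCast]

/-- Crude, from Λ(n) ≤ log n ≤ n; it suffices because the limit is needed only for s > 2, that is a
> 3/2. -/
theorem abs_chebyshevDelta_natCast_le {N : ℕ} (hN : 1 ≤ N) :
    |chebyshevDelta N| ≤ (N : ℝ) ^ 2 := by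
  have hN' : (1 : ℝ) ≤ N := by exact_mod_cast hN
  have h0 : 0 ≤ chebyshevPsi N := by
    rw [chebyshevPsi_natCast]
    exact Finset.sum_nonneg fun n _ => vonMangoldt_nonneg
  have h1 : chebyshevPsi N ≤ (N : ℝ) ^ 2 := by
    rw [chebyshevPsi_natCast]
    calc ∑ n ∈ Finset.range N, vonMangoldt n ≤ ∑ n ∈ Finset.range N, (N : ℝ) := by
          refine Finset.sum_le_sum fun n hn => ?_
          have hn' : (n : ℝ) ≤ N := by exact_mod_cast (Finset.mem_range.1 hn).le
          exact vonMangoldt_le_log.trans ((Real.log_le_self n.cast_nonneg).trans hn')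
      _ = (N : ℝ) ^ 2 := by simp [pow_two]
  rw [chebyshevDelta, abs_le]
  constructor <;> nlinarith

theorem tendsto_chebyshevDelta_mul_rpow {s : ℝ} (hs : 2 < s) :
    Tendsto (fun N : ℕ => chebyshevDelta N * (N : ℝ) ^ (-s)) atTop (𝓝 0) := by
  have h1 : Tendsto (fun N : ℕ => (N : ℝ) ^ (-(s - 2))) atTop (𝓝 0) :=
    (tendsto_rpow_neg_atTop (by linarith)).comp tendsto_natCast_atTop_atTop
  refine squeeze_zero_norm' ?_ h1
  filter_upwards [eventually_ge_atTop 1] with N hN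
  have hN' : (0 : ℝ) < N := by exact_mod_cast hN
  rw [norm_mul, Real.norm_eq_abs, Real.norm_eq_abs,
    abs_of_pos (Real.rpow_pos_of_pos hN' _), show -(s - 2) = 2 + -s by ring,
    Real.rpow_add hN', Real.rpow_two]
  gcongr
  exact abs_chebyshevDelta_natCast_le hN

theorem tendsto_sum_vonMangoldt_mul_rpow {s : ℝ} (hs : 1 < s) :
    Tendsto (fun N : ℕ => ((∑ n ∈ Finset.range N, vonMangoldt n * (n : ℝ) ^ (-s) : ℝ) : ℂ))
      atTop (𝓝 (-(deriv riemannZeta s / riemannZeta s))) := by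
  have h1 := (LSeriesSummable_vonMangoldt (s := s) (by simpa using hs)).LSeriesHasSum
  rw [LSeries_vonMangoldt_eq_deriv_riemannZeta_div (by simpa using hs)] at h1
  rw [← neg_div]
  refine h1.tendsto_sum_nat.congr fun N => ?_
  rw [Complex.ofReal_sum]
  refine Finset.sum_congr rfl fun n _ => ?_
  rcases eq_or_ne n 0 with rfl | hn
  · simp
  · rw [LSeries.term_of_ne_zero hn, Complex.ofReal_mul, Complex.ofReal_cpow n.cast_nonneg,
      Complex.ofReal_neg, Complex.cpow_neg, Complex.ofReal_natCast, div_eq_mul_inv]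

theorem tendsto_intervalIntegral_rpow_neg {s : ℝ} (hs : 1 < s) :
    Tendsto (fun N : ℕ => ∫ y in (1 : ℝ)..N, y ^ (-s)) atTop (𝓝 (1 / (s - 1))) := by
  have h1 := MeasureTheory.intervalIntegral_tendsto_integral_Ioi (1 : ℝ)
    (integrableOn_Ioi_rpow_of_lt (by linarith : -s < -1) one_pos) tendsto_natCast_atTop_atTop
  rw [integral_Ioi_rpow_of_lt (by linarith : -s < -1) one_pos, Real.one_rpow] at h1
  rwa [show 1 / (s - 1) = -1 / (-s + 1) by rw [← neg_sub, div_neg, neg_div]; ring_nf]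

-- Divide the integrable product with the kernel at a = 1 by that kernel, which is positive for t >
-- 0.
open MeasureTheory in
theorem aestronglyMeasurable_guinandTrunc {X : ℝ} (hX : 1 < X) :
    AEStronglyMeasurable (guinandTrunc X) (volume.restrict (Ioi 0)) := by
  have h1 := (integrableOn_guinandTrunc_mul one_pos hX).aestronglyMeasurable.mul
    (Measurable.aestronglyMeasurable (by fun_prop :
      Measurable fun t : ℝ => (t / ((1 : ℝ) ^ 2 + t ^ 2) ^ 2)⁻¹))
  refine h1.congr ?_
  filter_upwards [ae_restrict_mem measurableSet_Ioi] with t ht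
  have ht : 0 < t := ht
  rw [Pi.mul_apply, mul_assoc, mul_inv_cancel₀ (by positivity), mul_one]

theorem tendsto_integral_guinandTrunc_mul {a : ℝ} (ha : 3 / 2 < a) :
    Tendsto (fun N : ℕ =>
      ((∫ t in Ioi (0 : ℝ), guinandTrunc N t * (t / (a ^ 2 + t ^ 2) ^ 2) : ℝ) : ℂ)) atTop
      (𝓝 (Real.pi / (4 * a) * (deriv riemannZeta (1 / 2 + a) / riemannZeta (1 / 2 + a) +
        1 / ((1 / 2 + a) - 1)))) := by
  have h1 := tendsto_sum_vonMangoldt_mul_rpow (s := 1 / 2 + a) (by linarith)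
  have h2 := (Complex.continuous_ofReal.tendsto _).comp
    (tendsto_chebyshevDelta_mul_rpow (s := 1 / 2 + a) (by linarith))
  have h3 := (Complex.continuous_ofReal.tendsto _).comp
    (tendsto_intervalIntegral_rpow_neg (s := 1 / 2 + a) (by linarith))
  have h4 := ((h1.neg.add h2).add h3).const_mul ((Real.pi : ℂ) / (4 * a))
  push_cast at h4
  rw [neg_neg, add_zero] at h4
  refine h4.congr' ?_
  filter_upwards [eventually_gt_atTop 1] with N hN
  have hN' : (1 : ℝ) < N := by exact_mod_cast hN
  rw [integral_guinandTrunc_mul (by linarith) hN', Nat.ceil_natCast]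
  simp only [Function.comp_apply]
  push_cast
  rfl

/-! ### Passage to the limit and conclusion. -/

open MeasureTheory in
/-- If the truncated Guinand expressions converge almost everywhere along the integers with a
linear bound, the limit represents `ζ'/ζ(s) + 1/(s-1)` and the Riemann hypothesis follows. -/
theorem riemannHypothesis_of_ae_tendsto_guinandTrunc {f : ℝ → ℝ} {C : ℝ}
    (hlim : ∀ᵐ t ∂volume.restrict (Ioi (0 : ℝ)),
      Tendsto (fun N : ℕ => guinandTrunc N t) atTop (𝓝 (f t)))
    (hbound : ∀ᶠ N : ℕ in atTop, ∀ᵐ t ∂volume.restrict (Ioi (0 : ℝ)),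
      |guinandTrunc N t| ≤ C * (1 + t)) :
    RiemannHypothesis := by
  obtain ⟨N₀, hN₀⟩ := eventually_atTop.1 hbound
  -- The 2 ensures X > 1, as the integral formulas require.
  set M := max N₀ 2 with hM
  have hM1 (n : ℕ) : (1 : ℝ) < ((n + M : ℕ) : ℝ) := by
    exact_mod_cast (by omega : 1 < n + M)
  have hb : ∀ n : ℕ, ∀ᵐ t ∂volume.restrict (Ioi (0 : ℝ)),
      |guinandTrunc ((n + M : ℕ) : ℝ) t| ≤ C * (1 + t) := fun n => hN₀ _ (by omega)
  have hlim' : ∀ᵐ t ∂volume.restrict (Ioi (0 : ℝ)),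
      Tendsto (fun n : ℕ => guinandTrunc ((n + M : ℕ) : ℝ) t) atTop (𝓝 (f t)) :=
    hlim.mono fun t ht => ht.comp (tendsto_add_atTop_nat M)
  have hfm : AEStronglyMeasurable f (volume.restrict (Ioi 0)) :=
    aestronglyMeasurable_of_tendsto_ae atTop
      (fun n => aestronglyMeasurable_guinandTrunc (hM1 n)) hlim'
  have hfb : ∀ᵐ t ∂volume.restrict (Ioi (0 : ℝ)), |f t| ≤ C * (1 + t) := by
    filter_upwards [hlim', ae_all_iff.2 hb] with t ht htb
    exact le_of_tendsto' ht.abs htb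
  set F : ℂ → ℂ := fun a => ∫ t in Ioi (0 : ℝ), (f t : ℂ) * (t / (a ^ 2 + (t : ℂ) ^ 2) ^ 2)
    with hF
  have hreal : ∀ a : ℝ, 3 / 2 < a → F a = Real.pi / (4 * a) *
      (deriv riemannZeta (1 / 2 + a) / riemannZeta (1 / 2 + a) + 1 / ((1 / 2 + a) - 1)) := by
    intro a ha
    have ha0 : 0 < a := by linarith
    have h1 : F a = ((∫ t in Ioi (0 : ℝ), f t * (t / (a ^ 2 + t ^ 2) ^ 2) : ℝ) : ℂ) := by
      rw [← integral_complex_ofReal]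
      simp only [hF]
      push_cast
      rfl
    have hdom : Integrable
        (fun t => C * (t / (a ^ 2 + t ^ 2) ^ 2 + t * (t / (a ^ 2 + t ^ 2) ^ 2))) :=
      ((integrable_div_add_sq_sq ha0).add (integrable_mul_div_add_sq_sq ha0)).const_mul C
    have h2 : Tendsto (fun n : ℕ =>
        ∫ t in Ioi (0 : ℝ), guinandTrunc ((n + M : ℕ) : ℝ) t * (t / (a ^ 2 + t ^ 2) ^ 2)) atTop
        (𝓝 (∫ t in Ioi (0 : ℝ), f t * (t / (a ^ 2 + t ^ 2) ^ 2))) := by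
      refine tendsto_integral_of_dominated_convergence
        (fun t => C * (t / (a ^ 2 + t ^ 2) ^ 2 + t * (t / (a ^ 2 + t ^ 2) ^ 2)))
        (fun n => (integrableOn_guinandTrunc_mul ha0 (hM1 n)).aestronglyMeasurable)
        hdom.integrableOn (fun n => ?_) ?_
      · filter_upwards [hb n, ae_restrict_mem measurableSet_Ioi] with t ht ht0
        have ht0 : 0 < t := ht0
        have hk : 0 ≤ t / (a ^ 2 + t ^ 2) ^ 2 := by positivity
        rw [norm_mul, Real.norm_eq_abs, Real.norm_eq_abs, abs_of_nonneg hk]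
        calc _ ≤ C * (1 + t) * (t / (a ^ 2 + t ^ 2) ^ 2) := by gcongr
          _ = _ := by ring
      · filter_upwards [hlim'] with t ht
        exact ht.mul_const _
    rw [h1]
    exact tendsto_nhds_unique ((Complex.continuous_ofReal.tendsto _).comp h2)
      ((tendsto_integral_guinandTrunc_mul ha).comp (tendsto_add_atTop_nat M))
  refine riemannHypothesis_of_logDeriv_add_eq
    (H := fun s => 4 * (s - 1 / 2) / Real.pi * F (s - 1 / 2)) (σ₀ := 2) ?_ (by norm_num) ?_
  · intro s hs
    have hs' : 0 < (s - 1 / 2).re := by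
      have : (1 : ℝ) / 2 < s.re := hs
      have e : (s - 1 / 2).re = s.re - 1 / 2 := by simp
      rw [e]; linarith
    have hd : DifferentiableAt ℂ F (s - 1 / 2) :=
      differentiableAt_integral_mul_div_sq_add_sq_sq hfm hfb hs'
    have hd' : DifferentiableAt ℂ (fun s => F (s - 1 / 2)) s :=
      DifferentiableAt.comp (g := F) (f := fun s => s - 1 / 2) s hd (by fun_prop)
    exact (DifferentiableAt.mul (by fun_prop) hd').differentiableWithinAt
  · intro σ hσ
    have h1 := hreal (σ - 1 / 2) (by linarith)
    have hσ' : (σ : ℂ) - 1 / 2 ≠ 0 := by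
      have : ((σ - 1 / 2 : ℝ) : ℂ) ≠ 0 := Complex.ofReal_ne_zero.2 (by linarith)
      simpa using this
    have hpi : (Real.pi : ℂ) ≠ 0 := by exact_mod_cast Real.pi_ne_zero
    push_cast at h1
    rw [add_sub_cancel] at h1
    have hcancel : 4 * ((σ : ℂ) - 1 / 2) / Real.pi * (Real.pi / (4 * (σ - 1 / 2))) = 1 :=
      div_mul_div_cancel₀ hpi |>.trans (div_self (mul_ne_zero (by norm_num) hσ'))
    simp only [h1, ← mul_assoc, hcancel, one_mul]

theorem theorem6 (f : ℝ → ℝ) (E : Set ℝ)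
    (hE : E ⊆ Ici 0) (hE_discrete : IsDiscrete E)
    (hf : ContinuousOn f (Ici 0 \ E))
    (hlim : ∀ t ∈ Ici (0 : ℝ) \ E,
      Tendsto (fun X : ℝ => guinandTrunc X t) atTop (𝓝 (f t)))
    (hbound : ∃ C X₀ : ℝ, ∀ X : ℝ, X₀ ≤ X → ∀ t ∈ Ici (0 : ℝ) \ E,
      |guinandTrunc X t| ≤ C * Real.log (t + 2)) :
    RiemannHypothesis := by
  obtain ⟨C, X₀, hC⟩ := hbound
  have hE0 : ∀ᵐ t ∂MeasureTheory.volume.restrict (Ioi (0 : ℝ)), t ∈ Ici (0 : ℝ) \ E := by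
    -- A discrete subset of ℝ is countable, hence null.
    have hcount : E.Countable :=
      (HereditarilyLindelofSpace.isLindelof E).countable_of_isDiscrete hE_discrete
    filter_upwards [MeasureTheory.ae_restrict_of_ae (hcount.ae_notMem MeasureTheory.volume),
      MeasureTheory.ae_restrict_mem measurableSet_Ioi] with t h1 h2
    exact ⟨mem_Ici.2 (le_of_lt h2), h1⟩
  refine riemannHypothesis_of_ae_tendsto_guinandTrunc (f := f) (C := |C|)
    (hE0.mono fun t ht => (hlim t ht).comp tendsto_natCast_atTop_atTop) ?_
  filter_upwards [tendsto_natCast_atTop_atTop.eventually_ge_atTop X₀] with N hN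
  filter_upwards [hE0] with t ht
  have ht0 : 0 ≤ t := ht.1
  have hlog : 0 ≤ Real.log (t + 2) := Real.log_nonneg (by linarith)
  calc |guinandTrunc N t| ≤ C * Real.log (t + 2) := hC N hN t ht
    _ ≤ |C| * (1 + t) := by
      gcongr
      · exact le_abs_self C
      -- log(t+2) ≤ (t+2) - 1 turns the logarithmic bound into the linear one.
      · linarith [Real.log_le_sub_one_of_pos (by linarith : 0 < t + 2)]
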